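/- A \emph{two-outcome quantum board game} $G$ is an interactive protocol between a board, whose behaviour is fixed and known, and a player. It has finitely many rounds; all registers are finite-dimensional. In each round the board applies a prescribed quantum operation to its private register and the last message of the player, and sends a quantum message to the player; the player answers with a quantum message of a prescribed (positive) dimension. At the end the board applies a two-outcome measurement with outcomes in $\{0,1\}$ to its private register and the last message. A \emph{strategy} for $G$ consists of arbitrary quantum operations, one for each round, acting on the received message and a private finite-dimensional memory of the player and producing the reply and the new memory (initially the memory is trivial). Let $q_i$ be the maximal probability, over all strategies, of the outcome $i\in\{0,1\}$. When $G$ is played $n$ times in sequence, each game starts afresh after the previous one has ended, and the player learns the outcome of every game before the next game begins. A \emph{sequential strategy} may use in each game the outcomes of all previous games and the quantum memory left over from them. For $t=(t_a)_{a\in\{0,1\}^n}$ with $t_a\in\mathbb{R}$, let $$\mathrm{sval}(t)=\max_{S}\ \sum_{a\in\{0,1\}^n}t_a\Pr(a\mid S),$$ where $S$ ranges over all sequential strategies and $\Pr(a\mid S)$ is the probability that the vector of outcomes is $a$. Define $\mathrm{tval}$ recursively by $\mathrm{tval}(c)=c$ for $c\in\mathbb{R}$ (the case $n=0$) and, for $n\ge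 1$, with $t^{\leftarrow}_b=t_{0b}$ and $t^{\rightarrow}_b=t_{1b}$ for $b\in\{0,1\}^{n-1}$, $$\mathrm{tval}(t)=\max\bigl\{q_0\,\mathrm{tval}(t^{\leftarrow})+(1-q_0)\,\mathrm{tval}(t^{\rightarrow}),\ \ q_1\,\mathrm{tval}(t^{\rightarrow})+(1-q_1)\,\mathrm{tval}(t^{\leftarrow})\bigr\}.$$ For a set $\mathcal{S}$ of strategies for $G$, an \emph{$\mathcal{S}$-black-box strategy} is a sequential strategy that plays each game afresh with a strategy in $\mathcal{S}$ which is determined by the outcomes of the previous games. \textbf{Theorem.} For every two-outcome quantum board game $G$, the maximal probabilities $q_0,q_1$ are attained; and for every $n\ge 0$ and every $t\in\mathbb{R}^{\{0,1\}^n}$, the maximum that defines $\mathrm{sval}(t)$ is attained and $$\mathrm{sval}(t)=\mathrm{tval}(t).$$ Furthermore, whenever $S_0$ and $S_1$ are strategies for $G$ that achieve the outcomes $0$ and $1$ with probability $q_0$ and $q_1$ respectively, there is an $\{S_0,S_1\}$-black-box strategy $S$ with $\sum_{a}t_a\Pr(a\mid S)=\mathrm{tval}(t)$. -/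

import Mathlib

namespace QuantumBoard

open scoped Kronecker ComplexOrder

/-- A quantum operation (completely positive trace preserving map) from density matrices over the
register with basis `ι` to those over the register with basis `κ`, given by finitely many Kraus
operators. -/
structure Channel (ι κ : Type) [Fintype ι] [DecidableEq ι] [Fintype κ] where
  num : ℕ
  kraus : Fin num → Matrix κ ι ℂ
  tracePreserving : ∑ k, (kraus k).conjTranspose * kraus k = 1

namespace Channel

variable {ι κ ξ : Type} [Fintype ι] [DecidableEq ι] [Fintype κ] [Fintype ξ] [DecidableEq ξ]

/-- The operation applied to a state, `ρ ↦ ∑ₖ Kₖ ρ Kₖ†`. -/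
noncomputable def apply (C : Channel ι κ) (ρ : Matrix ι ι ℂ) : Matrix κ κ ℂ :=
  ∑ k, C.kraus k * ρ * (C.kraus k).conjTranspose

/-- The operation applied to the left part of a composite register, the right part being left
untouched. -/
noncomputable def applyLeft (C : Channel ι κ) (ρ : Matrix (ι × ξ) (ι × ξ) ℂ) :
    Matrix (κ × ξ) (κ × ξ) ℂ :=
  ∑ k, (C.kraus k ⊗ₖ (1 : Matrix ξ ξ ℂ)) * ρ * (C.kraus k ⊗ₖ (1 : Matrix ξ ξ ℂ)).conjTranspose

/-- The operation applied to the right part of a composite register, the left part being left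
untouched. -/
noncomputable def applyRight (C : Channel ι κ) (ρ : Matrix (ξ × ι) (ξ × ι) ℂ) :
    Matrix (ξ × κ) (ξ × κ) ℂ :=
  ∑ k, ((1 : Matrix ξ ξ ℂ) ⊗ₖ C.kraus k) * ρ * ((1 : Matrix ξ ξ ℂ) ⊗ₖ C.kraus k).conjTranspose

/-- The operation that discards a register (the trace). -/
noncomputable def discard (m : ℕ) : Channel (Fin m) (Fin 1) where
  num := m
  kraus j := Matrix.single 0 j 1
  tracePreserving := by
    ext a b
    simp [Matrix.sum_apply, Matrix.single_apply, Matrix.one_apply, ite_and]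

end Channel

/-- A two-outcome quantum measurement (POVM) with outcomes `0` and `1`. -/
structure Measurement (ι : Type) [Fintype ι] [DecidableEq ι] where
  effect : Fin 2 → Matrix ι ι ℂ
  posSemidef : ∀ i, (effect i).PosSemidef
  complete : effect 0 + effect 1 = 1

/-- The unnormalised state of the register `ξ` when the measurement is applied to the register `ι`
of a composite system in state `ρ` with outcome `i`: the partial trace over `ι` of `(Eᵢ ⊗ 1) ρ`.
Its trace is the probability of the outcome `i`. -/
noncomputable def Measurement.residual {ι ξ : Type} [Fintype ι] [DecidableEq ι]
    (E : Measurement ι) (ρ : Matrix (ι × ξ) (ι × ξ) ℂ) (i : Fin 2) : Matrix ξ ξ ℂ :=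
  Matrix.of fun u v => ∑ p, ∑ q, E.effect i p q * ρ (q, u) (p, v)

/-- `BoardGame b y`: the rules of the (remainder of a) two-outcome quantum board game at a moment
when the board holds a private register of dimension `b` together with a message of dimension `y`
just received from the player. Either the board measures these and the game ends, or there is a
further round: the board applies a quantum operation that produces its new private register and a
message of dimension `x` for the player, who has to reply by a message of dimension `y' > 0`. -/
inductive BoardGame : ℕ → ℕ → Type
  | measure {b y : ℕ} (E : Measurement (Fin b × Fin y)) : BoardGame b y
  | round {b y b' x y' : ℕ} (O : Channel (Fin b × Fin y) (Fin b' × Fin x)) (hy : 0 < y')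
      (next : BoardGame b' y') : BoardGame b y

/-- A two-outcome quantum board game: at the start all registers are trivial (so the first
operation of the board is the preparation of a state). -/
abbrev Game : Type := BoardGame 1 1

/-- A strategy of the player in (the remainder of) a board game when the player's private memory has
dimension `m`: in each round, an arbitrary quantum operation that turns the received message and
the memory into a reply and a new memory, of any finite dimension `m'`. -/
inductive Strategy : {b y : ℕ} → BoardGame b y → ℕ → Type
  | done {b y m : ℕ} {E : Measurement (Fin b × Fin y)} : Strategy (BoardGame.measure E) m
  | act {b y b' x y' m : ℕ} {O : Channel (Fin b × Fin y) (Fin b' × Fin x)} {hy : 0 < y'}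
      {next : BoardGame b' y'} (m' : ℕ) (A : Channel (Fin x × Fin m) (Fin y' × Fin m'))
      (s : Strategy next m') : Strategy (BoardGame.round O hy next) m

namespace Strategy

/-- The dimension of the player's memory at the end of the game. -/
def finalDim : {b y m : ℕ} → {G : BoardGame b y} → Strategy G m → ℕ
  | _, _, m, _, done => m
  | _, _, _, _, act _ _ s => s.finalDim

/-- Playing from the joint state `ρ` of the board's register, the player's last message and the
player's memory: the unnormalised final state of the player's memory when the outcome is `i`. -/
noncomputable def run : {b y m : ℕ} → {G : BoardGame b y} → (s : Strategy G m) →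
    Matrix ((Fin b × Fin y) × Fin m) ((Fin b × Fin y) × Fin m) ℂ → Fin 2 →
    Matrix (Fin s.finalDim) (Fin s.finalDim) ℂ
  | _, _, _, BoardGame.measure E, done, ρ, i => E.residual ρ i
  | _, _, _, BoardGame.round O _ _, act _ A s, ρ, i =>
      s.run (Matrix.reindex (Equiv.prodAssoc _ _ _).symm (Equiv.prodAssoc _ _ _).symm
        (A.applyRight
          (Matrix.reindex (Equiv.prodAssoc _ _ _) (Equiv.prodAssoc _ _ _) (O.applyLeft ρ)))) i

/-- Playing a whole game from the memory state `σ`: the unnormalised final memory state when the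
outcome is `i`. -/
noncomputable def play {G : Game} {m : ℕ} (s : Strategy G m) (σ : Matrix (Fin m) (Fin m) ℂ)
    (i : Fin 2) : Matrix (Fin s.finalDim) (Fin s.finalDim) ℂ :=
  s.run ((1 : Matrix (Fin 1 × Fin 1) (Fin 1 × Fin 1) ℂ) ⊗ₖ σ) i

/-- The probability of the outcome `i` in a single game in which the player uses `s`, starting with
a trivial memory. -/
noncomputable def prob {G : Game} (s : Strategy G 1) (i : Fin 2) : ℝ :=
  (s.play 1 i).trace.re

end Strategy

/-- The largest probability `qᵢ` with which the player can force the outcome `i` in one game. -/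
noncomputable def Game.maxProb (G : Game) (i : Fin 2) : ℝ :=
  sSup (Set.range fun s : Strategy G 1 => s.prob i)

/-- `SeqStrategy G n m`: a strategy for `n` games `G` played one after the other, when the player's
memory has dimension `m`. Before each game the player may apply any quantum operation to the
memory. After each game the player learns its outcome and continues, with the memory left over
from the previous games, by a strategy that may depend on that outcome. -/
inductive SeqStrategy (G : Game) : ℕ → ℕ → Type
  | nil {m : ℕ} : SeqStrategy G 0 m
  | cons {n m : ℕ} (m' : ℕ) (C : Channel (Fin m) (Fin m')) (s : Strategy G m')
      (next : Fin 2 → SeqStrategy G n s.finalDim) : SeqStrategy G (n + 1) m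

namespace SeqStrategy

variable {G : Game}

/-- The weight of the outcome vector `a` when the memory is initially in the (possibly
unnormalised) state `σ`. -/
noncomputable def weight : {n m : ℕ} → SeqStrategy G n m → Matrix (Fin m) (Fin m) ℂ →
    (Fin n → Fin 2) → ℝ
  | 0, _, nil, σ, _ => σ.trace.re
  | _ + 1, _, cons _ C s next, σ, a =>
      (next (a 0)).weight (s.play (C.apply σ) (a 0)) (Fin.tail a)

/-- The probability of the outcome vector `a`, the player starting with a trivial memory. -/
noncomputable def prob {n : ℕ} (S : SeqStrategy G n 1) (a : Fin n → Fin 2) : ℝ :=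
  S.weight 1 a

/-- The expected value of the target vector `t`. -/
noncomputable def value {n : ℕ} (S : SeqStrategy G n 1) (t : (Fin n → Fin 2) → ℝ) : ℝ :=
  ∑ a, t a * S.prob a

end SeqStrategy

/-- The sequential value of the target vector `t`. -/
noncomputable def Game.sval (G : Game) {n : ℕ} (t : (Fin n → Fin 2) → ℝ) : ℝ :=
  sSup (Set.range fun S : SeqStrategy G n 1 => S.value t)

/-- The tree value of the target vector `t`, with parameters `q₀` and `q₁`. -/
noncomputable def tval (q₀ q₁ : ℝ) : {n : ℕ} → ((Fin n → Fin 2) → ℝ) → ℝ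
  | 0, t => t Fin.elim0
  | n + 1, t =>
      max (q₀ * tval q₀ q₁ (fun b : Fin n → Fin 2 => t (Fin.cons 0 b))
            + (1 - q₀) * tval q₀ q₁ (fun b : Fin n → Fin 2 => t (Fin.cons 1 b)))
          (q₁ * tval q₀ q₁ (fun b : Fin n → Fin 2 => t (Fin.cons 1 b))
            + (1 - q₁) * tval q₀ q₁ (fun b : Fin n → Fin 2 => t (Fin.cons 0 b)))

/-- The pure black-box strategy for `n` games in which each game is played afresh (the memory being
discarded before it) by the single-game strategy `c h`, where `h` is the list of the outcomes of
the previous games, the earliest first. -/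
noncomputable def blackBox {G : Game} (c : List (Fin 2) → Strategy G 1) :
    (n m : ℕ) → SeqStrategy G n m
  | 0, _ => SeqStrategy.nil
  | n + 1, m => SeqStrategy.cons 1 (Channel.discard m) (c [])
      fun i => blackBox (fun h => c (i :: h)) n _

/-- `S` is an `𝒮`-black-box strategy for `n` games: a pure black-box strategy in which every game is
played, depending on the previous outcomes, by a member of `𝒮`. -/
def IsBlackBox {G : Game} (𝒮 : Set (Strategy G 1)) {n : ℕ} (S : SeqStrategy G n 1) : Prop :=
  ∃ c : List (Fin 2) → Strategy G 1, (∀ h, c h ∈ 𝒮) ∧ S = blackBox c n 1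

end QuantumBoard

open scoped Kronecker ComplexOrder

/-! Two facts carry the theorem. (1) Leftover memory is worthless: a player could prepare any memory
state privately at the start of a fresh game, so whatever happened before, outcome `i` has
conditional probability at most `q_i` (`trace_play_le`). By induction on the number of games, the
expected target is linear in the probability of the next outcome, hence maximal when the better of
the two outcomes gets its largest probability. This gives `sval ≤ tval` (`sum_weight_le`), and
following that recipe with `S₀` and `S₁` gives equality (`sum_weight_blackBox`).

(2) The `q_i` are attained although memories may have any dimension. A strategy matters only through
its effect, an operator on the initial registers (`trace_run`). Stinespring dilation
(`exists_dilation`) reduces each operation to an isometry into a memory of fixed dimension, delaying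
the rest to the next round. So the effects form a compact set (`isCompact_effects`). -/

namespace QuantumBoard

set_option linter.unusedSectionVars false

/-! ### Channels and their duals in the Heisenberg picture. -/

namespace Channel

variable {ι κ ξ μ : Type} [Fintype ι] [DecidableEq ι] [Fintype κ] [DecidableEq κ] [Fintype ξ]
  [DecidableEq ξ] [Fintype μ] [DecidableEq μ]

/-- The dual (Heisenberg picture) of `Channel.applyLeft`. -/
noncomputable def adjLeft (C : Channel ι κ) (X : Matrix (κ × ξ) (κ × ξ) ℂ) :
    Matrix (ι × ξ) (ι × ξ) ℂ :=
  ∑ k, (C.kraus k ⊗ₖ (1 : Matrix ξ ξ ℂ)).conjTranspose * X * (C.kraus k ⊗ₖ (1 : Matrix ξ ξ ℂ))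

/-- The dual (Heisenberg picture) of `Channel.applyRight`. -/
noncomputable def adjRight (C : Channel ι κ) (X : Matrix (ξ × κ) (ξ × κ) ℂ) :
    Matrix (ξ × ι) (ξ × ι) ℂ :=
  ∑ k, ((1 : Matrix ξ ξ ℂ) ⊗ₖ C.kraus k).conjTranspose * X * ((1 : Matrix ξ ξ ℂ) ⊗ₖ C.kraus k)

theorem trace_mul_applyLeft (C : Channel ι κ) (X : Matrix (κ × ξ) (κ × ξ) ℂ)
    (ρ : Matrix (ι × ξ) (ι × ξ) ℂ) :
    (X * C.applyLeft ρ).trace = (C.adjLeft X * ρ).trace := by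
  simp only [applyLeft, adjLeft, Finset.mul_sum, Finset.sum_mul, Matrix.trace_sum]
  refine Finset.sum_congr rfl fun k _ => ?_
  rw [← Matrix.mul_assoc, Matrix.trace_mul_comm]
  simp only [Matrix.mul_assoc]

theorem trace_mul_applyRight (C : Channel ι κ) (X : Matrix (ξ × κ) (ξ × κ) ℂ)
    (ρ : Matrix (ξ × ι) (ξ × ι) ℂ) :
    (X * C.applyRight ρ).trace = (C.adjRight X * ρ).trace := by
  simp only [applyRight, adjRight, Finset.mul_sum, Finset.sum_mul, Matrix.trace_sum]
  refine Finset.sum_congr rfl fun k _ => ?_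
  rw [← Matrix.mul_assoc, Matrix.trace_mul_comm]
  simp only [Matrix.mul_assoc]

theorem applyLeft_posSemidef (C : Channel ι κ) {ρ : Matrix (ι × ξ) (ι × ξ) ℂ}
    (h : ρ.PosSemidef) : (C.applyLeft ρ).PosSemidef :=
  Matrix.posSemidef_sum _ fun _ _ => h.mul_mul_conjTranspose_same _

theorem applyRight_posSemidef (C : Channel ι κ) {ρ : Matrix (ξ × ι) (ξ × ι) ℂ}
    (h : ρ.PosSemidef) : (C.applyRight ρ).PosSemidef :=
  Matrix.posSemidef_sum _ fun _ _ => h.mul_mul_conjTranspose_same _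

theorem apply_posSemidef (C : Channel ι κ) {ρ : Matrix ι ι ℂ}
    (h : ρ.PosSemidef) : (C.apply ρ).PosSemidef :=
  Matrix.posSemidef_sum _ fun _ _ => h.mul_mul_conjTranspose_same _

theorem trace_apply (C : Channel ι κ) (ρ : Matrix ι ι ℂ) : (C.apply ρ).trace = ρ.trace := by
  have h : (C.apply ρ).trace = ∑ k, ((C.kraus k).conjTranspose * C.kraus k * ρ).trace := by
    rw [apply, Matrix.trace_sum]
    refine Finset.sum_congr rfl fun k _ => ?_
    rw [Matrix.trace_mul_comm, Matrix.mul_assoc]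
  rw [h, ← Matrix.trace_sum, ← Finset.sum_mul, C.tracePreserving, Matrix.one_mul]

theorem applyRight_kronecker (C : Channel ι κ) (τ : Matrix ξ ξ ℂ) (ρ : Matrix ι ι ℂ) :
    C.applyRight (τ ⊗ₖ ρ) = τ ⊗ₖ C.apply ρ := by
  ext ⟨a, b⟩ ⟨c, d⟩
  simp only [applyRight, apply, Matrix.conjTranspose_kronecker, ← Matrix.mul_kronecker_mul,
    Matrix.one_mul, Matrix.conjTranspose_one, Matrix.mul_one, Matrix.sum_apply,
    Matrix.kroneckerMap_apply, Finset.mul_sum]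

theorem adjLeft_one (C : Channel ι κ) : C.adjLeft (1 : Matrix (κ × ξ) (κ × ξ) ℂ) = 1 := by
  simp only [adjLeft, Matrix.mul_one, Matrix.conjTranspose_kronecker, ← Matrix.mul_kronecker_mul,
    Matrix.conjTranspose_one]
  rw [← Matrix.one_kronecker_one (m := ι) (n := ξ), ← C.tracePreserving]
  ext ⟨a, b⟩ ⟨c, d⟩
  simp only [Matrix.sum_apply, Matrix.kroneckerMap_apply, Finset.sum_mul]

theorem adjRight_one (C : Channel ι κ) : C.adjRight (1 : Matrix (ξ × κ) (ξ × κ) ℂ) = 1 := by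
  simp only [adjRight, Matrix.mul_one, Matrix.conjTranspose_kronecker, ← Matrix.mul_kronecker_mul,
    Matrix.conjTranspose_one]
  rw [← Matrix.one_kronecker_one (m := ξ) (n := ι), ← C.tracePreserving]
  ext ⟨a, b⟩ ⟨c, d⟩
  simp only [Matrix.sum_apply, Matrix.kroneckerMap_apply, Finset.mul_sum]

theorem adjLeft_add (C : Channel ι κ) (X Y : Matrix (κ × ξ) (κ × ξ) ℂ) :
    C.adjLeft (X + Y) = C.adjLeft X + C.adjLeft Y := by
  simp only [adjLeft, Matrix.mul_add, Matrix.add_mul, Finset.sum_add_distrib]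

theorem adjRight_add (C : Channel ι κ) (X Y : Matrix (ξ × κ) (ξ × κ) ℂ) :
    C.adjRight (X + Y) = C.adjRight X + C.adjRight Y := by
  simp only [adjRight, Matrix.mul_add, Matrix.add_mul, Finset.sum_add_distrib]

theorem adjRight_kronecker_one (C : Channel ι κ) (X : Matrix ξ ξ ℂ) :
    C.adjRight (X ⊗ₖ (1 : Matrix κ κ ℂ)) = X ⊗ₖ (1 : Matrix ι ι ℂ) := by
  rw [← C.tracePreserving]
  ext ⟨a, b⟩ ⟨c, d⟩
  simp only [adjRight, Matrix.conjTranspose_kronecker, ← Matrix.mul_kronecker_mul,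
    Matrix.one_mul, Matrix.conjTranspose_one, Matrix.mul_one, Matrix.sum_apply,
    Matrix.kroneckerMap_apply, Finset.mul_sum]

/-- Sequential composition: first `D`, then `C`. -/
noncomputable def comp (C : Channel κ μ) (D : Channel ι κ) : Channel ι μ where
  num := C.num * D.num
  kraus k := C.kraus (finProdFinEquiv.symm k).1 * D.kraus (finProdFinEquiv.symm k).2
  tracePreserving := by
    rw [Equiv.sum_comp finProdFinEquiv.symm
      (fun p => (C.kraus p.1 * D.kraus p.2).conjTranspose * (C.kraus p.1 * D.kraus p.2)),
      Fintype.sum_prod_type_right, ← D.tracePreserving]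
    refine Finset.sum_congr rfl fun k _ => ?_
    have h : ∀ l, (C.kraus l * D.kraus k).conjTranspose * (C.kraus l * D.kraus k) =
        (D.kraus k).conjTranspose * ((C.kraus l).conjTranspose * C.kraus l) * D.kraus k := by
      intro l; simp only [Matrix.conjTranspose_mul, Matrix.mul_assoc]
    simp only [h, ← Matrix.sum_mul, ← Matrix.mul_sum, C.tracePreserving, Matrix.mul_one]

theorem comp_adjRight (C : Channel κ μ) (D : Channel ι κ) (X : Matrix (ξ × μ) (ξ × μ) ℂ) :
    (C.comp D).adjRight X = D.adjRight (C.adjRight X) := by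
  have h : (C.comp D).adjRight X = ∑ p : Fin C.num × Fin D.num,
      ((1 : Matrix ξ ξ ℂ) ⊗ₖ (C.kraus p.1 * D.kraus p.2)).conjTranspose * X *
        ((1 : Matrix ξ ξ ℂ) ⊗ₖ (C.kraus p.1 * D.kraus p.2)) :=
    Equiv.sum_comp finProdFinEquiv.symm (fun p : Fin C.num × Fin D.num =>
      ((1 : Matrix ξ ξ ℂ) ⊗ₖ (C.kraus p.1 * D.kraus p.2)).conjTranspose * X *
        ((1 : Matrix ξ ξ ℂ) ⊗ₖ (C.kraus p.1 * D.kraus p.2)))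
  rw [h, Fintype.sum_prod_type_right]
  simp only [adjRight, Matrix.mul_sum, Matrix.sum_mul]
  refine Finset.sum_congr rfl fun k _ => Finset.sum_congr rfl fun l _ => ?_
  have h' : (1 : Matrix ξ ξ ℂ) ⊗ₖ (C.kraus l * D.kraus k) =
      ((1 : Matrix ξ ξ ℂ) ⊗ₖ C.kraus l) * ((1 : Matrix ξ ξ ℂ) ⊗ₖ D.kraus k) := by
    rw [← Matrix.mul_kronecker_mul, Matrix.one_mul]
  rw [h', Matrix.conjTranspose_mul]
  simp only [Matrix.mul_assoc]

/-- The channel acting on the right part of a composite register. -/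
noncomputable def extend (μ : Type) [Fintype μ] [DecidableEq μ] (C : Channel ι κ) :
    Channel (μ × ι) (μ × κ) where
  num := C.num
  kraus k := (1 : Matrix μ μ ℂ) ⊗ₖ C.kraus k
  tracePreserving := by simpa [adjRight] using C.adjRight_one (ξ := μ)

theorem extend_adjRight (C : Channel ι κ) (X : Matrix (ξ × (μ × κ)) (ξ × (μ × κ)) ℂ) :
    Matrix.reindex (Equiv.prodAssoc _ _ _).symm (Equiv.prodAssoc _ _ _).symm
      ((C.extend μ).adjRight X) =
    C.adjRight (Matrix.reindex (Equiv.prodAssoc _ _ _).symm (Equiv.prodAssoc _ _ _).symm X) := by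
  simp only [adjRight, extend, Matrix.reindex_apply, Equiv.symm_symm]
  have hs : ∀ (n : ℕ) (M : Fin n → Matrix (ξ × (μ × ι)) (ξ × (μ × ι)) ℂ),
      (∑ k, M k).submatrix (Equiv.prodAssoc ξ μ ι) (Equiv.prodAssoc ξ μ ι) =
        ∑ k, (M k).submatrix (Equiv.prodAssoc ξ μ ι) (Equiv.prodAssoc ξ μ ι) := by
    intro n M
    ext i j
    simp [Matrix.sum_apply]
  refine (hs _ _).trans (Finset.sum_congr rfl fun k _ => ?_)
  have h : (1 : Matrix (ξ × μ) (ξ × μ) ℂ) ⊗ₖ C.kraus k =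
      ((1 : Matrix ξ ξ ℂ) ⊗ₖ ((1 : Matrix μ μ ℂ) ⊗ₖ C.kraus k)).submatrix
        (Equiv.prodAssoc _ _ _) (Equiv.prodAssoc _ _ _) := by
    rw [← Matrix.one_kronecker_one, ← Matrix.kronecker_assoc]
    ext ⟨⟨a, b⟩, c⟩ ⟨⟨d, e⟩, f⟩
    rfl
  rw [h, Matrix.conjTranspose_submatrix, Matrix.submatrix_mul_equiv, Matrix.submatrix_mul_equiv]

/-- Kraus operators on different tensor factors commute. This lets an operation on the player's
memory be moved past the board's operation. -/
theorem adjLeft_adjRight {ι' κ' : Type} [Fintype ι'] [DecidableEq ι'] [Fintype κ'] [DecidableEq κ']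
    (O : Channel ι κ) (D : Channel ι' κ')
    (X : Matrix (κ × κ') (κ × κ') ℂ) :
    O.adjLeft (D.adjRight X) = D.adjRight (O.adjLeft X) := by
  simp only [adjLeft, adjRight, Matrix.mul_sum, Matrix.sum_mul]
  rw [Finset.sum_comm]
  refine Finset.sum_congr rfl fun k _ => Finset.sum_congr rfl fun l _ => ?_
  have h : ((1 : Matrix κ κ ℂ) ⊗ₖ D.kraus k) * (O.kraus l ⊗ₖ (1 : Matrix ι' ι' ℂ)) =
      (O.kraus l ⊗ₖ (1 : Matrix κ' κ' ℂ)) * ((1 : Matrix ι ι ℂ) ⊗ₖ D.kraus k) := by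
    simp only [← Matrix.mul_kronecker_mul, Matrix.one_mul, Matrix.mul_one]
  have h' := congrArg Matrix.conjTranspose h
  simp only [Matrix.conjTranspose_mul] at h'
  calc _ = ((O.kraus l ⊗ₖ (1 : Matrix ι' ι' ℂ)).conjTranspose *
        ((1 : Matrix κ κ ℂ) ⊗ₖ D.kraus k).conjTranspose) * X *
        (((1 : Matrix κ κ ℂ) ⊗ₖ D.kraus k) * (O.kraus l ⊗ₖ (1 : Matrix ι' ι' ℂ))) := by
        simp only [Matrix.mul_assoc]
    _ = _ := by
        rw [h, h']
        simp only [Matrix.mul_assoc]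

/-- The channel with a single Kraus operator. -/
def ofIsometry (V : Matrix κ ι ℂ) (hV : V.conjTranspose * V = 1) : Channel ι κ where
  num := 1
  kraus _ := V
  tracePreserving := by simpa using hV

end Channel

/-! ### Stinespring dilation with bounded memory. -/

/-- Gram–Schmidt is applied to the columns of `T`, padded by zero vectors; the first `N` basis
vectors form `U`. By triangularity they span every column of `T`, so the projection `U * Uᴴ` fixes
`T`. -/
theorem exists_isometry_range {κ ν : Type} [Fintype κ] [DecidableEq κ] [Fintype ν]
    (N : ℕ) (hν : Fintype.card ν = N) (hN : N ≤ Fintype.card κ) (T : Matrix κ ν ℂ) :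
    ∃ U : Matrix κ (Fin N) ℂ, U.conjTranspose * U = 1 ∧ U * (U.conjTranspose * T) = T := by
  classical
  let e : Fin N ≃ ν := (Fintype.equivFinOfCardEq hν).symm
  let d := Fintype.card κ
  let f : Fin d → EuclideanSpace ℂ κ := fun j =>
    if h : j.1 < N then WithLp.toLp 2 (fun c => T c (e ⟨j, h⟩)) else 0
  have hd : Module.finrank ℂ (EuclideanSpace ℂ κ) = Fintype.card (Fin d) := by simp [d]
  let b := InnerProductSpace.gramSchmidtOrthonormalBasis hd f
  let U : Matrix κ (Fin N) ℂ := Matrix.of fun c n => b (Fin.castLE hN n) c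
  have hU : U.conjTranspose * U = 1 := by
    ext i j
    have h1 : inner ℂ (b (Fin.castLE hN i)) (b (Fin.castLE hN j)) = if i = j then 1 else 0 := by
      rw [b.inner_eq_ite]
      simp
    rw [Matrix.one_apply, ← h1, EuclideanSpace.inner_eq_star_dotProduct, Matrix.mul_apply]
    simp [U, dotProduct, mul_comm]
  have hmem : ∀ v : ν, ∃ x : Fin N → ℂ, U.mulVec x = fun c => T c v := by
    intro v
    obtain ⟨j, rfl⟩ := e.surjective v
    have hf : f (Fin.castLE hN j) = WithLp.toLp 2 (fun c => T c (e j)) := by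
      simp [f]
    refine ⟨fun i => inner ℂ (b (Fin.castLE hN i)) (f (Fin.castLE hN j)), ?_⟩
    have h2 := b.sum_repr' (f (Fin.castLE hN j))
    have h3 : ∑ i : Fin N, inner ℂ (b (Fin.castLE hN i)) (f (Fin.castLE hN j)) •
        b (Fin.castLE hN i) = f (Fin.castLE hN j) := by
      rw [← h2]
      refine Finset.sum_of_injOn (Fin.castLE hN) (Fin.castLE_injective hN).injOn
        (by simp) ?_ (by intro i _; rw [h2])
      intro i _ hi
      have hlt : Fin.castLE hN j < i := by
        by_contra hle
        refine hi ⟨⟨i.1, lt_of_le_of_lt (Fin.le_def.mp (not_lt.mp hle)) j.2⟩, by simp, rfl⟩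
      rw [InnerProductSpace.gramSchmidtOrthonormalBasis_inv_triangular hd f hlt, zero_smul]
    ext c
    have h4 := congrArg (fun w : EuclideanSpace ℂ κ => w c) (h3.trans hf)
    simp only [WithLp.ofLp_sum, Finset.sum_apply, PiLp.smul_apply, smul_eq_mul] at h4
    rw [← h4, Matrix.mulVec, dotProduct]
    exact Finset.sum_congr rfl fun i _ => mul_comm _ _
  choose x hx using hmem
  have hT : T = U * Matrix.of (fun n v => x v n) := by
    ext c v
    rw [← congrFun (hx v) c]
    rfl
  refine ⟨U, hU, ?_⟩
  rw [hT, ← Matrix.mul_assoc U.conjTranspose, hU, Matrix.one_mul]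

namespace Channel

/-- Every operation with reply register `α` factors through an isometry into a memory of bounded
dimension, followed by an operation on that memory. -/
theorem exists_dilation {α ι : Type} [Fintype α] [DecidableEq α] [Fintype ι] [DecidableEq ι]
    {m' : ℕ} (A : Channel ι (α × Fin m')) (N : ℕ) (hN : Fintype.card (α × ι) = N) :
    ∃ (V : Matrix (α × Fin N) ι ℂ) (hV : V.conjTranspose * V = 1) (D : Channel (Fin N) (Fin m')),
      ∀ {ξ : Type} [Fintype ξ] [DecidableEq ξ] (X : Matrix (ξ × (α × Fin m')) (ξ × (α × Fin m')) ℂ),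
        A.adjRight X = (ofIsometry V hV).adjRight ((D.extend α).adjRight X) := by
  -- Zero Kraus operators do not change `A`, but `N` of them make room for `N` orthonormal vectors.
  -- The exception `m' = 0` forces `ι` to be empty, and then `N = 0`.
  let K : Fin (A.num + N) → Matrix (α × Fin m') ι ℂ := Fin.append A.kraus 0
  have hcard : N ≤ Fintype.card (Fin (A.num + N) × Fin m') := by
    rcases Nat.eq_zero_or_pos m' with h | h
    · subst h
      have : IsEmpty ι := by
        refine ⟨fun i => ?_⟩
        have := congrFun (congrFun A.tracePreserving i) i
        simp [Matrix.sum_apply, Matrix.mul_apply] at this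
      rw [← hN]
      simp
    · simp only [Fintype.card_prod, Fintype.card_fin]
      nlinarith
  -- The Kraus operators are reshaped into one matrix `T`, with rows (Kraus index, new memory) and
  -- columns (reply, input). In `T = U * (Uᴴ * T)`, the factor `U` becomes the delayed operation `D`
  -- and `Uᴴ * T` becomes `V`.
  obtain ⟨U, hU, hUT⟩ := exists_isometry_range N hN hcard
    (Matrix.of fun (p : Fin (A.num + N) × Fin m') (q : α × ι) => K p.1 (q.1, p.2) q.2)
  let D : Channel (Fin N) (Fin m') :=
    { num := A.num + N
      kraus := fun k => Matrix.of fun c n => U (k, c) n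
      tracePreserving := by
        rw [← hU]
        ext i j
        simp [Matrix.sum_apply, Matrix.mul_apply, Fintype.sum_prod_type] }
  let V : Matrix (α × Fin N) ι ℂ := Matrix.of fun p i =>
    (U.conjTranspose * (Matrix.of fun (p : Fin (A.num + N) × Fin m') (q : α × ι) =>
      K p.1 (q.1, p.2) q.2)) p.2 (p.1, i)
  have hDV : ∀ k : Fin (A.num + N), (D.extend α).kraus k * V = K k := by
    intro k
    ext ⟨a, c⟩ p
    have := congrFun (congrFun hUT (k, c)) (a, p)
    rw [Matrix.mul_apply] at this
    rw [Matrix.mul_apply, Fintype.sum_prod_type]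
    simp only [extend, Matrix.kroneckerMap_apply, Matrix.one_apply, ite_mul, one_mul, zero_mul]
    rw [Finset.sum_comm]
    simpa [D, V] using this
  have hsum : ∀ {ω : Type} (g : Matrix (α × Fin m') ι ℂ → Matrix ω ω ℂ), g 0 = 0 →
      ∑ k, g (K k) = ∑ k, g (A.kraus k) := by
    intro ω g hg
    simp [Fin.sum_univ_add, K, hg]
  -- Inserting the completeness relation of `D.extend α` between `Vᴴ` and `V` turns the product into
  -- that of `K`, hence of `A`.
  have hV : V.conjTranspose * V = 1 := by
    have h1 := (D.extend α).tracePreserving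
    have h0 : ∀ (E : Matrix (α × Fin m') (α × Fin N) ℂ) (M : Matrix (α × Fin m') ι ℂ), E * V = M →
        V.conjTranspose * (E.conjTranspose * E) * V = M.conjTranspose * M := by
      rintro E _ rfl
      simp only [Matrix.conjTranspose_mul, Matrix.mul_assoc]
    have h2 : V.conjTranspose * (∑ k, ((D.extend α).kraus k).conjTranspose * (D.extend α).kraus k)
        * V = ∑ k, (K k).conjTranspose * K k := by
      rw [Matrix.mul_sum, Matrix.sum_mul]
      exact Finset.sum_congr rfl fun k _ => h0 _ _ (hDV k)
    rw [h1, Matrix.mul_one] at h2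
    rw [h2, hsum (fun M => M.conjTranspose * M) (by simp), A.tracePreserving]
  refine ⟨V, hV, D, fun {ξ} _ _ X => ?_⟩
  rw [← comp_adjRight]
  have h1 : A.adjRight X = ∑ k, ((1 : Matrix ξ ξ ℂ) ⊗ₖ K k).conjTranspose * X *
      ((1 : Matrix ξ ξ ℂ) ⊗ₖ K k) :=
    (hsum (fun M => ((1 : Matrix ξ ξ ℂ) ⊗ₖ M).conjTranspose * X * ((1 : Matrix ξ ξ ℂ) ⊗ₖ M))
      (by simp)).symm
  have h0 : ∀ (E : Matrix (α × Fin m') (α × Fin N) ℂ) (M : Matrix (α × Fin m') ι ℂ), E * V = M →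
      ((1 : Matrix ξ ξ ℂ) ⊗ₖ M).conjTranspose * X * ((1 : Matrix ξ ξ ℂ) ⊗ₖ M) =
      ((1 : Matrix ξ ξ ℂ) ⊗ₖ V).conjTranspose * (((1 : Matrix ξ ξ ℂ) ⊗ₖ E).conjTranspose * X *
        ((1 : Matrix ξ ξ ℂ) ⊗ₖ E)) * ((1 : Matrix ξ ξ ℂ) ⊗ₖ V) := by
    rintro E _ rfl
    have h' : (1 : Matrix ξ ξ ℂ) ⊗ₖ (E * V) =
        ((1 : Matrix ξ ξ ℂ) ⊗ₖ E) * ((1 : Matrix ξ ξ ℂ) ⊗ₖ V) := by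
      rw [← Matrix.mul_kronecker_mul, Matrix.one_mul]
    rw [h', Matrix.conjTranspose_mul]
    simp only [Matrix.mul_assoc]
  rw [h1, comp_adjRight]
  refine Eq.trans ?_ (Fin.sum_univ_one _).symm
  simp only [adjRight, Matrix.mul_sum, Matrix.sum_mul]
  exact Finset.sum_congr rfl fun k _ => h0 _ _ (hDV k)

end Channel

/-! ### Measurements and the effects of strategies. -/

theorem exists_conjTranspose_mul_self {ι : Type} [Fintype ι] [DecidableEq ι] {A : Matrix ι ι ℂ}
    (h : A.PosSemidef) : ∃ B : Matrix ι ι ℂ, A = B.conjTranspose * B := by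
  open scoped MatrixOrder Matrix.Norms.L2Operator in
  exact CStarAlgebra.nonneg_iff_eq_star_mul_self.mp (Matrix.nonneg_iff_posSemidef.mpr h)

namespace Measurement

variable {ι ξ : Type} [Fintype ι] [DecidableEq ι] [Fintype ξ] [DecidableEq ξ]

theorem trace_residual (E : Measurement ι) (ρ : Matrix (ι × ξ) (ι × ξ) ℂ) (i : Fin 2) :
    (E.residual ρ i).trace = ((E.effect i ⊗ₖ (1 : Matrix ξ ξ ℂ)) * ρ).trace := by
  simp only [residual, Matrix.trace, Matrix.diag, Matrix.of_apply, Matrix.mul_apply,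
    Fintype.sum_prod_type, Matrix.kroneckerMap_apply, Matrix.one_apply, mul_ite, mul_one, mul_zero,
    ite_mul, zero_mul, Finset.sum_ite_eq, Finset.mem_univ, if_true]
  rw [Finset.sum_comm]

/-- Writing the effect as `Bᴴ * B` gives a Kraus form, with operators (row `k` of `B`) ⊗ 1. -/
theorem residual_posSemidef (E : Measurement ι) {ρ : Matrix (ι × ξ) (ι × ξ) ℂ}
    (h : ρ.PosSemidef) (i : Fin 2) : (E.residual ρ i).PosSemidef := by
  obtain ⟨B, hB⟩ := exists_conjTranspose_mul_self (E.posSemidef i)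
  let M : ι → Matrix ξ (ι × ξ) ℂ := fun k => Matrix.of fun u p => if u = p.2 then B k p.1 else 0
  have : E.residual ρ i = ∑ k, M k * ρ * (M k).conjTranspose := by
    ext u v
    simp only [residual, hB, Matrix.of_apply, Matrix.sum_apply, Matrix.mul_apply, M,
      Matrix.conjTranspose_apply, Fintype.sum_prod_type, apply_ite star, star_zero, ite_mul,
      zero_mul, mul_ite, mul_zero, Finset.sum_ite_eq, Finset.mem_univ, if_true, Finset.sum_mul]
    rw [Finset.sum_comm (γ := ι) (f := fun c x => ∑ x_1, B c x_1 * ρ (x_1, u) (x, v) * star (B c x))]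
    refine Finset.sum_congr rfl fun p _ => ?_
    rw [Finset.sum_comm]
    exact Finset.sum_congr rfl fun c _ => Finset.sum_congr rfl fun q _ => by ring
  rw [this]
  exact Matrix.posSemidef_sum _ fun _ _ => h.mul_mul_conjTranspose_same _

end Measurement

namespace Strategy

/-- The operator on the joint register of board and player that gives the probability of the
outcome `i` when the player continues with `s`. -/
noncomputable def effect : {b y m : ℕ} → {G : BoardGame b y} → Strategy G m → Fin 2 →
    Matrix ((Fin b × Fin y) × Fin m) ((Fin b × Fin y) × Fin m) ℂ
  | _, _, _, BoardGame.measure E, done, i => E.effect i ⊗ₖ 1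
  | _, _, _, BoardGame.round O _ _, act _ A s, i =>
      O.adjLeft (Matrix.reindex (Equiv.prodAssoc _ _ _).symm (Equiv.prodAssoc _ _ _).symm
        (A.adjRight
          (Matrix.reindex (Equiv.prodAssoc _ _ _) (Equiv.prodAssoc _ _ _) (s.effect i))))

theorem trace_mul_reindex {ι κ : Type} [Fintype ι] [Fintype κ] (e : ι ≃ κ)
    (X : Matrix κ κ ℂ) (ρ : Matrix ι ι ℂ) :
    (X * Matrix.reindex e e ρ).trace = (Matrix.reindex e.symm e.symm X * ρ).trace := by
  have : X * Matrix.reindex e e ρ = Matrix.reindex e e (Matrix.reindex e.symm e.symm X * ρ) := by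
    simp only [Matrix.reindex_apply, ← Matrix.submatrix_mul_equiv _ _ _ e.symm _]
    simp
  rw [this]
  exact Equiv.sum_comp e.symm (fun i => (Matrix.reindex e.symm e.symm X * ρ) i i)

/-- Duality, round by round. The space of effects does not depend on `s.finalDim`, so strategies
with different memories become comparable. -/
theorem trace_run {b y m : ℕ} {G : BoardGame b y} (s : Strategy G m)
    (ρ : Matrix ((Fin b × Fin y) × Fin m) ((Fin b × Fin y) × Fin m) ℂ) (i : Fin 2) :
    (s.run ρ i).trace = (s.effect i * ρ).trace := by
  induction s with
  | done => exact Measurement.trace_residual _ _ _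
  | act m' A s ih =>
    refine (ih _).trans ?_
    rw [effect, trace_mul_reindex, Equiv.symm_symm, Channel.trace_mul_applyRight,
      trace_mul_reindex, Channel.trace_mul_applyLeft]

theorem run_posSemidef {b y m : ℕ} {G : BoardGame b y} (s : Strategy G m)
    {ρ : Matrix ((Fin b × Fin y) × Fin m) ((Fin b × Fin y) × Fin m) ℂ} (h : ρ.PosSemidef)
    (i : Fin 2) : (s.run ρ i).PosSemidef := by
  induction s with
  | done => exact Measurement.residual_posSemidef _ h _
  | act m' A s ih =>
    exact ih ((A.applyRight_posSemidef ((Channel.applyLeft_posSemidef _ h).submatrix _)).submatrix _)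

theorem effect_add {b y m : ℕ} {G : BoardGame b y} (s : Strategy G m) :
    s.effect 0 + s.effect 1 = 1 := by
  induction s with
  | @done b y m E =>
    rw [effect, effect, ← Matrix.add_kronecker, E.complete, Matrix.one_kronecker_one]
  | @act b y b' x y' m O hy next m' A s ih =>
    have h : ∀ {ι κ : Type} [Fintype ι] [Fintype κ] (e : ι ≃ κ) (X Y : Matrix ι ι ℂ),
      Matrix.reindex e e X + Matrix.reindex e e Y = Matrix.reindex e e (X + Y) := fun _ _ _ => rfl
    rw [effect, effect, ← Channel.adjLeft_add, h, ← Channel.adjRight_add, h, ih]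
    simp [Channel.adjRight_one, Channel.adjLeft_one]

/-- A strategy may be preceded by an operation on the player's memory. -/
theorem exists_precomp {b y m m' : ℕ} {G : BoardGame b y} (s : Strategy G m)
    (D : Channel (Fin m') (Fin m)) :
    ∃ s' : Strategy G m', ∀ i, s'.effect i = D.adjRight (s.effect i) := by
  cases s with
  | done => exact ⟨done, fun i => (D.adjRight_kronecker_one _).symm⟩
  | act m'' A s =>
    -- `D` commutes with the board's operation, so the player's first operation absorbs it.
    refine ⟨act m'' (A.comp (D.extend _)) s, fun i => ?_⟩
    rw [effect, Channel.comp_adjRight, Channel.extend_adjRight, Channel.adjLeft_adjRight, effect]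

/-- The player discards everything and always replies with basis state 0, which exists because reply
dimensions are positive. -/
theorem exists_strategy {b y : ℕ} (G : BoardGame b y) (m : ℕ) : Nonempty (Strategy G m) := by
  induction G generalizing m with
  | measure E => exact ⟨done⟩
  | @round b y b' x y' O hy next ih =>
    obtain ⟨s⟩ := ih 1
    let A₀ : Channel (Fin x × Fin m) (Fin y' × Fin 1) :=
      { num := x * m
        kraus := fun j => Matrix.single (⟨0, hy⟩, 0) (finProdFinEquiv.symm j) 1
        tracePreserving := by
          rw [Equiv.sum_comp finProdFinEquiv.symm (fun j : Fin x × Fin m =>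
            (Matrix.single ((⟨0, hy⟩, 0) : Fin y' × Fin 1) j (1 : ℂ)).conjTranspose *
              Matrix.single ((⟨0, hy⟩, 0) : Fin y' × Fin 1) j (1 : ℂ))]
          ext a b
          simp [Matrix.sum_apply, Matrix.single_apply, Matrix.one_apply, ite_and] }
    exact ⟨act 1 A₀ s⟩

/-! ### Compactness of the set of effects. -/

theorem isCompact_isometries (ι κ : Type) [Fintype ι] [DecidableEq ι] [Fintype κ] :
    IsCompact {V : Matrix κ ι ℂ | V.conjTranspose * V = 1} := by
  have h1 : IsCompact (Set.univ.pi fun _ : κ => Set.univ.pi fun _ : ι => Metric.closedBall (0 : ℂ) 1) :=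
    isCompact_univ_pi fun _ => isCompact_univ_pi fun _ => isCompact_closedBall _ _
  refine h1.of_isClosed_subset ?_ ?_
  · exact isClosed_eq (continuous_id.matrix_conjTranspose.matrix_mul continuous_id)
      continuous_const
  · intro V hV a _ p _
    change Matrix κ ι ℂ at V
    have h2 : (V.conjTranspose * V) p p = 1 := by
      rw [show V.conjTranspose * V = 1 from hV, Matrix.one_apply_eq]
    replace h2 := congrArg Complex.re h2
    simp only [Matrix.mul_apply, Matrix.conjTranspose_apply, Complex.one_re,
      Complex.re_sum] at h2
    have h3 : ∀ c, (star (V c p) * V c p).re = ‖V c p‖ ^ 2 := by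
      intro c
      rw [← Complex.normSq_eq_norm_sq, Complex.normSq_apply]
      simp
    simp only [h3] at h2
    have h4 : ‖V a p‖ ^ 2 ≤ 1 := by
      rw [← h2]
      exact Finset.single_le_sum (f := fun c => ‖V c p‖ ^ 2) (fun _ _ => sq_nonneg _)
        (Finset.mem_univ a)
    rw [mem_closedBall_zero_iff]
    exact (sq_le_one_iff₀ (norm_nonneg _)).mp h4

/-- Induction on the game, for all memory dimensions at once. By dilation, the effects of a round
are the continuous image of pairs (isometry, effect of the remaining game), with new memory of the
fixed dimension `y' * (x * m)`. -/
theorem isCompact_effects {b y : ℕ} (G : BoardGame b y) (m : ℕ) (i : Fin 2) :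
    IsCompact (Set.range fun s : Strategy G m => s.effect i) := by
  induction G generalizing m with
  | measure E =>
    have : (Set.range fun s : Strategy (BoardGame.measure E) m => s.effect i) =
        {E.effect i ⊗ₖ 1} := by
      ext X
      constructor
      · rintro ⟨s, rfl⟩
        cases s
        rfl
      · rintro rfl
        exact ⟨done, rfl⟩
    rw [this]
    exact isCompact_singleton
  | @round b y b' x y' O hy next ih =>
    have hN : Fintype.card (Fin y' × (Fin x × Fin m)) = y' * (x * m) := by simp
    have hc := (isCompact_isometries (Fin x × Fin m) (Fin y' × Fin (y' * (x * m)))).prod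
      (ih (y' * (x * m)))
    let Φ : Matrix (Fin y' × Fin (y' * (x * m))) (Fin x × Fin m) ℂ ×
        Matrix ((Fin b' × Fin y') × Fin (y' * (x * m))) ((Fin b' × Fin y') × Fin (y' * (x * m))) ℂ →
        Matrix ((Fin b × Fin y) × Fin m) ((Fin b × Fin y) × Fin m) ℂ := fun p =>
      O.adjLeft (Matrix.reindex (Equiv.prodAssoc _ _ _).symm (Equiv.prodAssoc _ _ _).symm
        (((1 : Matrix (Fin b') (Fin b') ℂ) ⊗ₖ p.1).conjTranspose *
          (Matrix.reindex (Equiv.prodAssoc _ _ _) (Equiv.prodAssoc _ _ _) p.2) *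
          ((1 : Matrix (Fin b') (Fin b') ℂ) ⊗ₖ p.1)))
    have hΦV : ∀ V hV F, Φ (V, F) =
        O.adjLeft (Matrix.reindex (Equiv.prodAssoc _ _ _).symm (Equiv.prodAssoc _ _ _).symm
        ((Channel.ofIsometry V hV).adjRight
          (Matrix.reindex (Equiv.prodAssoc _ _ _) (Equiv.prodAssoc _ _ _) F))) := by
      intro V hV F
      have : (Channel.ofIsometry V hV).adjRight
          (Matrix.reindex (Equiv.prodAssoc (Fin b') (Fin y') _) (Equiv.prodAssoc _ _ _) F) =
          ((1 : Matrix (Fin b') (Fin b') ℂ) ⊗ₖ V).conjTranspose *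
          (Matrix.reindex (Equiv.prodAssoc _ _ _) (Equiv.prodAssoc _ _ _) F) *
          ((1 : Matrix (Fin b') (Fin b') ℂ) ⊗ₖ V) := Fin.sum_univ_one _
      rw [this]
    have hΦ : Continuous Φ := by
      have hk : Continuous fun p : Matrix (Fin y' × Fin (y' * (x * m))) (Fin x × Fin m) ℂ ×
          Matrix ((Fin b' × Fin y') × Fin (y' * (x * m)))
            ((Fin b' × Fin y') × Fin (y' * (x * m))) ℂ =>
          (1 : Matrix (Fin b') (Fin b') ℂ) ⊗ₖ p.1 := by
        refine continuous_matrix fun i j => ?_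
        exact continuous_const.mul (continuous_fst.matrix_elem _ _)
      have hl : Continuous fun X : Matrix ((Fin b' × Fin x) × Fin m) ((Fin b' × Fin x) × Fin m) ℂ =>
          O.adjLeft X :=
        continuous_finsetSum _ fun _ _ =>
          (continuous_const.matrix_mul continuous_id).matrix_mul continuous_const
      exact hl.comp (((hk.matrix_conjTranspose.matrix_mul
        (continuous_snd.matrix_submatrix _ _)).matrix_mul hk).matrix_submatrix _ _)
    convert hc.image hΦ using 1
    ext X
    constructor
    · rintro ⟨s, rfl⟩
      cases s with
      | act m' A s =>
        -- The arbitrary dimension `m'` is eliminated here: `V` replaces `A`, and `D` is pushed into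
        -- the remaining strategy.
        obtain ⟨V, hV, D, hA⟩ := A.exists_dilation (y' * (x * m)) hN
        obtain ⟨s', hs'⟩ := s.exists_precomp D
        refine ⟨(V, s'.effect i), ⟨hV, ⟨s', rfl⟩⟩, ?_⟩
        simp only [effect]
        rw [hΦV V hV, hA, hs']
        have h := Channel.extend_adjRight (μ := Fin y') D
          (Matrix.reindex (Equiv.prodAssoc (Fin b') _ _) (Equiv.prodAssoc _ _ _) (s.effect i))
        rw [show Matrix.reindex (Equiv.prodAssoc (Fin b') (Fin y') (Fin m')).symm
          (Equiv.prodAssoc _ _ _).symm (Matrix.reindex (Equiv.prodAssoc (Fin b') _ _)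
            (Equiv.prodAssoc _ _ _) (s.effect i)) = s.effect i from rfl] at h
        rw [← h]
        rfl
    · rintro ⟨⟨V, _⟩, ⟨hV, ⟨s, rfl⟩⟩, rfl⟩
      refine ⟨act _ (Channel.ofIsometry V hV) s, ?_⟩
      simp only [effect]
      rw [hΦV V hV]

end Strategy

/-! ### A single game: attainment, and the bound for arbitrary initial memory. -/

namespace Strategy

variable {G : Game}

theorem prob_eq_trace (s : Strategy G 1) (i : Fin 2) : s.prob i = (s.effect i).trace.re := by
  rw [prob, play, trace_run, Matrix.one_kronecker_one, Matrix.mul_one]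

theorem isGreatest_maxProb (G : Game) (i : Fin 2) :
    IsGreatest (Set.range fun s : Strategy G 1 => s.prob i) (G.maxProb i) := by
  have h : (Set.range fun s : Strategy G 1 => s.prob i) =
      (fun F : Matrix ((Fin 1 × Fin 1) × Fin 1) ((Fin 1 × Fin 1) × Fin 1) ℂ => F.trace.re) ''
        (Set.range fun s : Strategy G 1 => s.effect i) := by
    rw [← Set.range_comp]
    exact congrArg Set.range (funext fun s => s.prob_eq_trace i)
  have hc : IsCompact (Set.range fun s : Strategy G 1 => s.prob i) := by
    rw [h]
    exact (isCompact_effects G 1 i).image (Complex.continuous_re.comp continuous_id.matrix_trace)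
  have hn : (Set.range fun s : Strategy G 1 => s.prob i).Nonempty :=
    @Set.range_nonempty _ _ (exists_strategy G 1) _
  exact hc.isGreatest_sSup hn

theorem play_posSemidef {m : ℕ} (s : Strategy G m) {σ : Matrix (Fin m) (Fin m) ℂ}
    (h : σ.PosSemidef) (i : Fin 2) : (s.play σ i).PosSemidef :=
  s.run_posSemidef (Matrix.PosSemidef.one.kronecker h) i

theorem trace_play_add {m : ℕ} (s : Strategy G m) (σ : Matrix (Fin m) (Fin m) ℂ) :
    (s.play σ 0).trace.re + (s.play σ 1).trace.re = σ.trace.re := by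
  rw [play, play, trace_run, trace_run, ← Complex.add_re, ← Matrix.trace_add, ← Matrix.add_mul,
    effect_add, Matrix.one_mul, Matrix.trace_kronecker]
  simp

theorem trace_play_smul {m : ℕ} (s : Strategy G m) (r : ℝ) (σ : Matrix (Fin m) (Fin m) ℂ)
    (i : Fin 2) : (s.play ((r : ℂ) • σ) i).trace.re = r * (s.play σ i).trace.re := by
  rw [play, play, trace_run, trace_run, Matrix.kronecker_smul, Matrix.mul_smul, Matrix.trace_smul,
    smul_eq_mul, Complex.re_ofReal_mul]

/-- With `σ = Bᴴ * B`, the columns of `Bᴴ` serve as Kraus operators; they are trace preserving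
because `σ` has trace 1. -/
theorem exists_preparation {m : ℕ} {σ : Matrix (Fin m) (Fin m) ℂ} (h : σ.PosSemidef)
    (ht : σ.trace = 1) : ∃ D : Channel (Fin 1) (Fin m), D.apply 1 = σ := by
  obtain ⟨B, hB⟩ := exists_conjTranspose_mul_self h
  refine ⟨⟨m, fun k => Matrix.of fun a _ => star (B k a), ?_⟩, ?_⟩
  · ext a b
    rw [Subsingleton.elim a 0, Subsingleton.elim b 0, Matrix.one_apply_eq, ← ht, hB]
    simp only [Matrix.sum_apply, Matrix.mul_apply, Matrix.conjTranspose_apply, Matrix.of_apply,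
      star_star, Matrix.trace, Matrix.diag]
    rw [Finset.sum_comm]
    exact Finset.sum_congr rfl fun p _ => Finset.sum_congr rfl fun q _ => mul_comm _ _
  · ext a b
    refine Eq.trans ?_ (congrFun (congrFun hB a) b).symm
    simp [Channel.apply, Matrix.sum_apply, Matrix.mul_apply]

/-- After normalisation, `σ` can be prepared from trivial memory within the first operation of the
player, so a fresh strategy does equally well. If the trace vanishes, `σ = 0`. -/
theorem trace_play_le {m : ℕ} (s : Strategy G m) {σ : Matrix (Fin m) (Fin m) ℂ}
    (h : σ.PosSemidef) (i : Fin 2) :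
    (s.play σ i).trace.re ≤ G.maxProb i * σ.trace.re := by
  have hnn : 0 ≤ σ.trace := h.trace_nonneg
  obtain ⟨hr, him⟩ := Complex.nonneg_iff.mp hnn
  have htr : σ.trace = (σ.trace.re : ℂ) := Complex.ext rfl him.symm
  rcases hr.eq_or_lt with h0 | hpos
  · have : σ = 0 := h.trace_eq_zero_iff.mp (by rw [htr, ← h0]; rfl)
    subst this
    rw [play, trace_run]
    simp
  · set r := σ.trace.re
    have hσ : σ = (r : ℂ) • ((r⁻¹ : ℝ) : ℂ) • σ := by
      rw [smul_smul, ← Complex.ofReal_mul, mul_inv_cancel₀ hpos.ne', Complex.ofReal_one, one_smul]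
    have hps : (((r⁻¹ : ℝ) : ℂ) • σ).PosSemidef :=
      h.smul (Complex.zero_le_real.mpr (inv_nonneg.mpr hr))
    obtain ⟨D, hD⟩ := exists_preparation hps (by
      rw [Matrix.trace_smul, htr, smul_eq_mul, ← Complex.ofReal_mul, inv_mul_cancel₀ hpos.ne',
        Complex.ofReal_one])
    obtain ⟨s', hs'⟩ := s.exists_precomp D
    have hp : (s.play (((r⁻¹ : ℝ) : ℂ) • σ) i).trace.re = s'.prob i := by
      rw [prob_eq_trace, hs', play, trace_run, ← hD, ← Channel.applyRight_kronecker,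
        Channel.trace_mul_applyRight, Matrix.one_kronecker_one, Matrix.mul_one]
    rw [hσ, trace_play_smul, hp, mul_comm]
    exact mul_le_mul_of_nonneg_right ((isGreatest_maxProb G i).2 ⟨s', rfl⟩) hr

end Strategy

/-! ### The upper bound for sequential strategies. -/

theorem sum_outcomes_succ {n : ℕ} (f : (Fin (n + 1) → Fin 2) → ℝ) :
    ∑ a, f a = ∑ b : Fin n → Fin 2, f (Fin.cons 0 b) + ∑ b : Fin n → Fin 2, f (Fin.cons 1 b) := by
  rw [← Equiv.sum_comp (Fin.consEquiv fun _ => Fin 2) f, Fintype.sum_prod_type, Fin.sum_univ_two]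
  rfl

namespace SeqStrategy

variable {G : Game}

theorem sum_weight_cons {n m m' : ℕ} (C : Channel (Fin m) (Fin m')) (s : Strategy G m')
    (next : Fin 2 → SeqStrategy G n s.finalDim) (σ : Matrix (Fin m) (Fin m) ℂ)
    (t : (Fin (n + 1) → Fin 2) → ℝ) :
    ∑ a, t a * (cons m' C s next).weight σ a =
      ∑ b, t (Fin.cons 0 b) * (next 0).weight (s.play (C.apply σ) 0) b +
      ∑ b, t (Fin.cons 1 b) * (next 1).weight (s.play (C.apply σ) 1) b :=
  sum_outcomes_succ _

/-- Unnormalised states keep the induction free of conditioning: the factor `σ.trace.re` carries the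
probability of the past. -/
theorem sum_weight_le {n m : ℕ} (S : SeqStrategy G n m) {σ : Matrix (Fin m) (Fin m) ℂ}
    (h : σ.PosSemidef) (t : (Fin n → Fin 2) → ℝ) :
    ∑ a, t a * S.weight σ a ≤ σ.trace.re * tval (G.maxProb 0) (G.maxProb 1) t := by
  induction S with
  | nil =>
    rw [Fintype.sum_subsingleton _ Fin.elim0, mul_comm, tval]
    exact le_rfl
  | cons m' C s next ih =>
    rw [sum_weight_cons, tval]
    have hC := C.apply_posSemidef h
    have h0 := ih 0 (s.play_posSemidef hC 0) (fun b => t (Fin.cons 0 b))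
    have h1 := ih 1 (s.play_posSemidef hC 1) (fun b => t (Fin.cons 1 b))
    have hs := s.trace_play_add (C.apply σ)
    have l0 := s.trace_play_le hC 0
    have l1 := s.trace_play_le hC 1
    rw [C.trace_apply] at hs l0 l1
    have hσ : 0 ≤ σ.trace.re := (Complex.nonneg_iff.mp h.trace_nonneg).1
    refine (add_le_add h0 h1).trans ?_
    rw [mul_max_of_nonneg _ _ hσ, le_max_iff]
    set x := (s.play (C.apply σ) 0).trace.re
    set y := (s.play (C.apply σ) 1).trace.re
    set u := tval (G.maxProb 0) (G.maxProb 1) (fun b => t (Fin.cons 0 b))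
    set v := tval (G.maxProb 0) (G.maxProb 1) (fun b => t (Fin.cons 1 b))
    -- With `x + y` fixed, `x * u + y * v` grows with the weight of the better branch, and that
    -- weight is bounded by `l0` or `l1`.
    rcases le_total v u with huv | huv
    · left
      rw [show y = σ.trace.re - x by linarith]
      nlinarith [mul_le_mul_of_nonneg_right l0 (sub_nonneg.mpr huv)]
    · right
      rw [show x = σ.trace.re - y by linarith]
      nlinarith [mul_le_mul_of_nonneg_right l1 (sub_nonneg.mpr huv)]

theorem value_le {n : ℕ} (S : SeqStrategy G n 1) (t : (Fin n → Fin 2) → ℝ) :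
    S.value t ≤ tval (G.maxProb 0) (G.maxProb 1) t := by
  simpa [value, prob] using S.sum_weight_le Matrix.PosSemidef.one t

end SeqStrategy

/-! ### The optimal black-box strategy. -/

theorem Channel.discard_apply {m : ℕ} (σ : Matrix (Fin m) (Fin m) ℂ) :
    (Channel.discard m).apply σ = σ.trace • (1 : Matrix (Fin 1) (Fin 1) ℂ) := by
  have h : (Channel.discard m).apply σ = ((Channel.discard m).apply σ).trace • 1 := by
    ext a b
    rw [Subsingleton.elim a 0, Subsingleton.elim b 0]
    simp [Matrix.trace]
  rw [h, Channel.trace_apply]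

/-- The optimal choice, as a function of the list of previous outcomes, between a strategy `S₀` for
the outcome `0` and a strategy `S₁` for the outcome `1`. -/
noncomputable def optimalChoice {G : Game} (S₀ S₁ : Strategy G 1) (q₀ q₁ : ℝ) :
    {n : ℕ} → ((Fin n → Fin 2) → ℝ) → List (Fin 2) → Strategy G 1
  -- No game remains, so this value is never played; it must still lie in `{S₀, S₁}`, since
  -- `IsBlackBox` constrains the choice on every list.
  | 0, _, _ => S₀
  | n + 1, t, [] =>
      if q₁ * tval q₀ q₁ (fun b : Fin n → Fin 2 => t (Fin.cons 1 b))
            + (1 - q₁) * tval q₀ q₁ (fun b : Fin n → Fin 2 => t (Fin.cons 0 b)) ≤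
        q₀ * tval q₀ q₁ (fun b : Fin n → Fin 2 => t (Fin.cons 0 b))
            + (1 - q₀) * tval q₀ q₁ (fun b : Fin n → Fin 2 => t (Fin.cons 1 b)) then S₀ else S₁
  | n + 1, t, i :: h => optimalChoice S₀ S₁ q₀ q₁ (fun b : Fin n → Fin 2 => t (Fin.cons i b)) h

theorem optimalChoice_mem {G : Game} (S₀ S₁ : Strategy G 1) (q₀ q₁ : ℝ) {n : ℕ}
    (t : (Fin n → Fin 2) → ℝ) (h : List (Fin 2)) :
    optimalChoice S₀ S₁ q₀ q₁ t h ∈ ({S₀, S₁} : Set (Strategy G 1)) := by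
  induction n generalizing h with
  | zero => simp [optimalChoice]
  | succ n ih =>
    cases h with
    | nil =>
      rw [optimalChoice]
      split_ifs <;> simp
    | cons i h =>
      rw [optimalChoice]
      exact ih _ h

/-- Discarding the memory makes the next game independent of the past up to the scalar `σ.trace.re`.
Since the two outcome probabilities sum to 1, the chosen strategy realises exactly the larger term
of `tval`. -/
theorem sum_weight_blackBox {G : Game} {S₀ S₁ : Strategy G 1} {q₀ q₁ : ℝ} (h₀ : S₀.prob 0 = q₀)
    (h₁ : S₁.prob 1 = q₁) {n m : ℕ} (t : (Fin n → Fin 2) → ℝ) {σ : Matrix (Fin m) (Fin m) ℂ}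
    (h : σ.PosSemidef) :
    ∑ a, t a * (blackBox (optimalChoice S₀ S₁ q₀ q₁ t) n m).weight σ a =
      σ.trace.re * tval q₀ q₁ t := by
  induction n generalizing m with
  | zero =>
    rw [Fintype.sum_subsingleton _ Fin.elim0, mul_comm, tval]
    rfl
  | succ n ih =>
    rw [blackBox, SeqStrategy.sum_weight_cons]
    have htr : σ.trace = (σ.trace.re : ℂ) :=
      Complex.ext rfl (Complex.nonneg_iff.mp h.trace_nonneg).2.symm
    have hC := (Channel.discard m).apply_posSemidef h
    have hp : ∀ (s : Strategy G 1) (i : Fin 2),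
        (s.play ((Channel.discard m).apply σ) i).trace.re = σ.trace.re * s.prob i := by
      intro s i
      rw [Channel.discard_apply, htr, Strategy.trace_play_smul]
      rfl
    have hsum : ∀ s : Strategy G 1, s.prob 0 + s.prob 1 = 1 := by
      intro s
      simpa [Strategy.prob] using s.trace_play_add 1
    simp only [optimalChoice]
    rw [ih (fun b => t (Fin.cons 0 b)) (Strategy.play_posSemidef _ hC 0),
      ih (fun b => t (Fin.cons 1 b)) (Strategy.play_posSemidef _ hC 1), hp, hp, tval]
    split_ifs with hle
    · rw [max_eq_left hle, ← h₀, show S₀.prob 1 = 1 - S₀.prob 0 by linarith [hsum S₀]]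
      ring
    · rw [max_eq_right (not_le.mp hle).le, ← h₁,
        show S₁.prob 0 = 1 - S₁.prob 1 by linarith [hsum S₁]]
      ring

end QuantumBoard

theorem mainTheorem1 (G : QuantumBoard.Game) :
    (∀ i : Fin 2,
      IsGreatest (Set.range fun s : QuantumBoard.Strategy G 1 => s.prob i) (G.maxProb i)) ∧
    ∀ (n : ℕ) (t : (Fin n → Fin 2) → ℝ),
      IsGreatest (Set.range fun S : QuantumBoard.SeqStrategy G n 1 => S.value t) (G.sval t) ∧
      G.sval t = QuantumBoard.tval (G.maxProb 0) (G.maxProb 1) t ∧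
      ∀ S₀ S₁ : QuantumBoard.Strategy G 1,
        S₀.prob 0 = G.maxProb 0 → S₁.prob 1 = G.maxProb 1 →
        ∃ S : QuantumBoard.SeqStrategy G n 1,
          QuantumBoard.IsBlackBox {S₀, S₁} S ∧
          S.value t = QuantumBoard.tval (G.maxProb 0) (G.maxProb 1) t := by
  refine ⟨QuantumBoard.Strategy.isGreatest_maxProb G, fun n t => ?_⟩
  have hbb : ∀ S₀ S₁ : QuantumBoard.Strategy G 1,
      S₀.prob 0 = G.maxProb 0 → S₁.prob 1 = G.maxProb 1 →
      ∃ S : QuantumBoard.SeqStrategy G n 1, QuantumBoard.IsBlackBox {S₀, S₁} S ∧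
        S.value t = QuantumBoard.tval (G.maxProb 0) (G.maxProb 1) t := by
    intro S₀ S₁ h₀ h₁
    refine ⟨_, ⟨_, QuantumBoard.optimalChoice_mem S₀ S₁ (G.maxProb 0) (G.maxProb 1) t, rfl⟩, ?_⟩
    have := QuantumBoard.sum_weight_blackBox h₀ h₁ t
      (Matrix.PosSemidef.one : (1 : Matrix (Fin 1) (Fin 1) ℂ).PosSemidef)
    simpa [QuantumBoard.SeqStrategy.value, QuantumBoard.SeqStrategy.prob] using this
  -- Attainment of `q₀` and `q₁` supplies optimal strategies; their black-box combination meets the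
  -- upper bound.
  obtain ⟨S₀, h₀⟩ := (QuantumBoard.Strategy.isGreatest_maxProb G 0).1
  obtain ⟨S₁, h₁⟩ := (QuantumBoard.Strategy.isGreatest_maxProb G 1).1
  obtain ⟨S, -, hS⟩ := hbb S₀ S₁ h₀ h₁
  have hg : IsGreatest (Set.range fun S : QuantumBoard.SeqStrategy G n 1 => S.value t)
      (QuantumBoard.tval (G.maxProb 0) (G.maxProb 1) t) :=
    ⟨⟨S, hS⟩, by rintro _ ⟨S', rfl⟩; exact S'.value_le t⟩
  have hs : G.sval t = QuantumBoard.tval (G.maxProb 0) (G.maxProb 1) t := hg.csSup_eq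
  exact ⟨hs ▸ hg, hs, hbb⟩
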